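/- All rings are associative but need not have an identity. A ring $R$ has local units if every finite subset of $R$ is contained in $eRe$ for some idempotent $e = e^2 \in R$. A left $R$-module $M$ is unitary if $RM = M$; let $R\mathrm{Mod}$ be the category of unitary left $R$-modules and all $R$-module homomorphisms. Let $\mathrm{Proj}\,R$ (respectively $\mathrm{proj}\,R$) be the full subcategory of $R\mathrm{Mod}$ consisting of the unitary left $R$-modules (respectively the finitely generated unitary left $R$-modules) that are projective in $R\mathrm{Mod}$. Two rings $R$ and $S$ with local units are Morita equivalent if there is a (covariant) equivalence of categories between $R\mathrm{Mod}$ and $S\mathrm{Mod}$. Theorem. Let $R$ and $S$ be two rings with local units. Then the following conditions are equivalent. (a) $R$ and $S$ are Morita equivalent. (b) There is an additive (covariant) equivalence $F : \mathrm{Proj}\,R \to \mathrm{Proj}\,S$ that preserves and reflects finitely generated modules, i.e. for each $P$ in $\mathrm{Proj}\,R$, the module $P$ is finitely generated if and only if $F(P)$ is finitely generated. (c) There is an additive (covariant) equivalence $\mathrm{proj}\,R \to \mathrm{proj}\,S$. -/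

import Mathlib

open CategoryTheory

universe u

/-- A (possibly non-unital) ring `R` has local units if every finite subset of `R` is contained in
`eRe` for some idempotent `e` of `R`. -/
def HasLocalUnits (R : Type u) [NonUnitalRing R] : Prop :=
  ∀ F : Finset R, ∃ e : R, e * e = e ∧ ∀ x ∈ F, ∃ r : R, x = e * r * e

/-- Left modules over a (possibly non-unital) ring. -/
class LeftModule (R : Type u) (M : Type u) [NonUnitalRing R] [AddCommGroup M]
    extends SMul R M where
  smul_add : ∀ (r : R) (x y : M), r • (x + y) = r • x + r • y
  add_smul : ∀ (r s : R) (x : M), (r + s) • x = r • x + s • x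
  mul_smul : ∀ (r s : R) (x : M), (r * s) • x = r • s • x

theorem LeftModule.smul_zero' {R M : Type u} [NonUnitalRing R] [AddCommGroup M] [LeftModule R M]
    (r : R) : r • (0 : M) = 0 := by
  have h : r • (0 : M) + r • (0 : M) = r • (0 : M) := by
    rw [← LeftModule.smul_add, add_zero]
  exact add_eq_left.mp h

/-- A left `R`-module `M` is unitary if `RM = M`, where `RM` is the set of finite sums of
elements `r • m`. -/
def IsUnitaryModule (R M : Type u) [NonUnitalRing R] [AddCommGroup M] [LeftModule R M] : Prop :=
  AddSubgroup.closure {x : M | ∃ (r : R) (m : M), x = r • m} = ⊤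

/-- A left `R`-module `M` is finitely generated if some finite subset of `M` is contained in no
proper submodule of `M`. -/
def IsFGModule (R M : Type u) [NonUnitalRing R] [AddCommGroup M] [LeftModule R M] : Prop :=
  ∃ X : Finset M, ∀ N : AddSubgroup M,
    (∀ (r : R), ∀ x ∈ N, r • x ∈ N) → (∀ x ∈ X, x ∈ N) → N = ⊤

/-- The group of `R`-module homomorphisms, as a subgroup of the group of additive maps. -/
def moduleHoms (R M N : Type u) [NonUnitalRing R] [AddCommGroup M] [LeftModule R M]
    [AddCommGroup N] [LeftModule R N] : AddSubgroup (M →+ N) where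
  carrier := {f | ∀ (r : R) (x : M), f (r • x) = r • f x}
  zero_mem' := fun r x => by
    rw [AddMonoidHom.zero_apply, AddMonoidHom.zero_apply, LeftModule.smul_zero']
  add_mem' := fun {f g} hf hg r x => by
    rw [AddMonoidHom.add_apply, AddMonoidHom.add_apply, hf, hg, LeftModule.smul_add]
  neg_mem' := fun {f} hf r x => by
    rw [AddMonoidHom.neg_apply, AddMonoidHom.neg_apply, hf]
    refine neg_eq_of_add_eq_zero_right ?_
    rw [← LeftModule.smul_add, add_neg_cancel, LeftModule.smul_zero']

/-- The unitary left `R`-modules, the objects of the category `RMod`. -/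
structure UnitaryMod (R : Type u) [NonUnitalRing R] : Type (u + 1) where
  carrier : Type u
  [addCommGroup : AddCommGroup carrier]
  [leftModule : LeftModule R carrier]
  unitary : IsUnitaryModule R carrier

attribute [instance] UnitaryMod.addCommGroup UnitaryMod.leftModule

/-- The category `RMod` of unitary left `R`-modules and all `R`-module homomorphisms. -/
instance UnitaryMod.category (R : Type u) [NonUnitalRing R] : Category.{u} (UnitaryMod R) where
  Hom M N := moduleHoms R M.carrier N.carrier
  id M := ⟨AddMonoidHom.id M.carrier, fun _ _ => rfl⟩
  comp f g := ⟨g.1.comp f.1, fun r x => by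
    rw [AddMonoidHom.comp_apply, AddMonoidHom.comp_apply, f.2, g.2]⟩

/-- Homomorphisms of modules are added pointwise. -/
instance UnitaryMod.preadditive (R : Type u) [NonUnitalRing R] : Preadditive (UnitaryMod R) where
  homGroup M N := inferInstanceAs (AddCommGroup (moduleHoms R M.carrier N.carrier))
  add_comp _ _ _ f f' g := Subtype.ext (AddMonoidHom.comp_add g.1 f.1 f'.1)
  comp_add _ _ _ f g g' := Subtype.ext (AddMonoidHom.add_comp g.1 g'.1 f.1)

/-- `R` and `S` are Morita equivalent if the categories `RMod` and `SMod` are equivalent. -/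
def AreMoritaEquivalent (R S : Type u) [NonUnitalRing R] [NonUnitalRing S] : Prop :=
  Nonempty (UnitaryMod R ≌ UnitaryMod S)

/-- The full subcategory `Proj R` of `RMod`: the unitary left `R`-modules that are projective
objects of `RMod`. -/
abbrev ProjMod (R : Type u) [NonUnitalRing R] : Type (u + 1) :=
  ObjectProperty.FullSubcategory (fun M : UnitaryMod R => Projective M)

/-- The full subcategory `proj R` of `RMod`: the finitely generated unitary left `R`-modules that
are projective objects of `RMod`. -/
abbrev FGProjMod (R : Type u) [NonUnitalRing R] : Type (u + 1) :=
  ObjectProperty.FullSubcategory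
    (fun M : UnitaryMod R => IsFGModule R M.carrier ∧ Projective M)

/-! The heart is (c) ⇒ (a): `RMod` can be rebuilt from the preadditive category `proj R`. The
restricted Yoneda functor sends M to Hom(-, M) on `proj R`, and it is fully faithful with the
additive presheaves of abelian groups as its essential image (`restrictedYoneda_faithful`,
`restrictedYoneda_full`, `essImage_restrictedYoneda`). An additive equivalence `proj R → proj S`
identifies the additive presheaves on both sides, hence `RMod` with `SMod`.

The left ideals Re with e idempotent carry the argument. They are finitely generated projective,
Hom(Re, M) is eM, and M is the directed union of the eM because R has local units. By the dual basis
lemma every object of `proj R` is a retract of some (Re)^n, so an additive presheaf is controlled by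
its values at the Re.

For (a) ⇒ (b), projectivity is categorical, an equivalence is automatically additive because
biproducts exist, and `isFGModule_iff` expresses finite generation by epimorphic families. (b) ⇒ (c)
is restriction to the finitely generated objects. -/

namespace LeftModule

variable {R M : Type u} [NonUnitalRing R] [AddCommGroup M] [LeftModule R M]

/-- The additive map `x ↦ r • x`. -/
def smulHom (r : R) : M →+ M where
  toFun x := r • x
  map_zero' := smul_zero' r
  map_add' := smul_add r

/-- The additive map `r ↦ r • x`. -/
def toSpan (x : M) : R →+ M where
  toFun r := r • x
  map_zero' := by
    have h : (0 : R) • x + (0 : R) • x = (0 : R) • x := by rw [← add_smul, add_zero]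
    exact add_eq_left.mp h
  map_add' r s := add_smul r s x

end LeftModule

/-! ### Local units acting on unitary modules -/

theorem HasLocalUnits.exists_idempotent {R : Type u} [NonUnitalRing R] (hR : HasLocalUnits R)
    (A : Finset R) :
    ∃ e : {e : R // IsIdempotentElem e}, ∀ a ∈ A, e.1 * a = a ∧ a * e.1 = a := by
  obtain ⟨e, he, h⟩ := hR A
  refine ⟨⟨e, he⟩, fun a ha => ?_⟩
  obtain ⟨r, rfl⟩ := h a ha
  refine ⟨?_, ?_⟩
  · rw [← mul_assoc, ← mul_assoc, he]
  · rw [mul_assoc, he]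

/-- Since x is a finite sum of terms r • m, a left unit for the coefficients r fixes x. Keeping the
finite set of coefficients lets a single idempotent serve several elements at once. -/
theorem IsUnitaryModule.exists_finset_smul_eq {R M : Type u} [NonUnitalRing R] [AddCommGroup M]
    [LeftModule R M] (hM : IsUnitaryModule R M) (x : M) :
    ∃ A : Finset R, ∀ e : R, (∀ a ∈ A, e * a = a) → e • x = x := by
  classical
  have hx : x ∈ AddSubgroup.closure {x : M | ∃ (r : R) (m : M), x = r • m} := by
    rw [show AddSubgroup.closure {x : M | ∃ (r : R) (m : M), x = r • m} = ⊤ from hM]; trivial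
  induction hx using AddSubgroup.closure_induction with
  | mem x h =>
    obtain ⟨r, m, rfl⟩ := h
    exact ⟨{r}, fun e he => by rw [← LeftModule.mul_smul, he r (by simp)]⟩
  | zero => exact ⟨∅, fun e _ => LeftModule.smul_zero' e⟩
  | add x y _ _ hx hy =>
    obtain ⟨A, hA⟩ := hx
    obtain ⟨B, hB⟩ := hy
    refine ⟨A ∪ B, fun e he => ?_⟩
    rw [LeftModule.smul_add, hA e fun a ha => he a (by simp [ha]),
      hB e fun a ha => he a (by simp [ha])]
  | neg x _ hx =>
    obtain ⟨A, hA⟩ := hx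
    refine ⟨A, fun e he => ?_⟩
    rw [show e • -x = -(e • x) from (LeftModule.smulHom e).map_neg x, hA e he]

theorem IsUnitaryModule.exists_idempotent {R M : Type u} [NonUnitalRing R] [AddCommGroup M]
    [LeftModule R M] (hR : HasLocalUnits R) (hM : IsUnitaryModule R M)
    (A : Finset R) (X : Finset M) :
    ∃ e : {e : R // IsIdempotentElem e}, (∀ a ∈ A, e.1 * a = a ∧ a * e.1 = a) ∧
      ∀ x ∈ X, e.1 • x = x := by
  classical
  choose B hB using hM.exists_finset_smul_eq
  obtain ⟨e, he⟩ := hR.exists_idempotent (A ∪ X.biUnion B)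
  refine ⟨e, fun a ha => he a (by simp [ha]), fun x hx => hB x e.1 fun b hb => (he b ?_).1⟩
  simp only [Finset.mem_union, Finset.mem_biUnion]
  exact Or.inr ⟨x, hx, hb⟩

theorem IsUnitaryModule.of_smul_eq {R M : Type u} [NonUnitalRing R] [AddCommGroup M]
    [LeftModule R M] (h : ∀ x : M, ∃ r : R, r • x = x) : IsUnitaryModule R M :=
  eq_top_iff.mpr fun x _ => by
    obtain ⟨r, hr⟩ := h x
    exact AddSubgroup.subset_closure ⟨r, x, hr.symm⟩

/-! ### Morphisms, quotients and epimorphisms in `RMod` -/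

namespace UnitaryMod

variable {R : Type u} [NonUnitalRing R]

theorem exists_idempotent (hR : HasLocalUnits R) (M : UnitaryMod R) (x : M.carrier) :
    ∃ e : {e : R // IsIdempotentElem e}, e.1 • x = x := by
  obtain ⟨e, -, he⟩ := M.unitary.exists_idempotent hR ∅ {x}
  exact ⟨e, he x (by simp)⟩

/-- The additive map underlying a morphism of unitary modules. -/
def toHom {M N : UnitaryMod R} (f : M ⟶ N) : M.carrier →+ N.carrier := f.1

/-- The morphism of unitary modules given by an additive map that commutes with the action. -/
def ofHom {M N : UnitaryMod R} (f : M.carrier →+ N.carrier)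
    (hf : ∀ (r : R) (x : M.carrier), f (r • x) = r • f x) : M ⟶ N := ⟨f, hf⟩

@[simp]
theorem toHom_smul {M N : UnitaryMod R} (f : M ⟶ N) (r : R) (x : M.carrier) :
    toHom f (r • x) = r • toHom f x := f.2 r x

@[simp]
theorem toHom_comp {M N P : UnitaryMod R} (f : M ⟶ N) (g : N ⟶ P) (x : M.carrier) :
    toHom (f ≫ g) x = toHom g (toHom f x) := rfl

theorem toHom_sum {M N : UnitaryMod R} {ι : Type*} (s : Finset ι) (f : ι → (M ⟶ N))
    (x : M.carrier) : toHom (∑ i ∈ s, f i) x = ∑ i ∈ s, toHom (f i) x :=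
  map_sum (AddMonoidHom.mk' (fun f : M ⟶ N => toHom f x) fun _ _ => rfl) f s

@[ext]
theorem hom_ext {M N : UnitaryMod R} {f g : M ⟶ N} (h : ∀ x, toHom f x = toHom g x) : f = g :=
  Subtype.ext (AddMonoidHom.ext h)

/-- The action on the quotient of a module by a submodule. -/
@[reducible]
def quotientLeftModule {M : Type u} [AddCommGroup M] [LeftModule R M] (N : AddSubgroup M)
    (hN : ∀ (r : R), ∀ x ∈ N, r • x ∈ N) : LeftModule R (M ⧸ N) where
  smul r := QuotientAddGroup.map N N (LeftModule.smulHom r) (hN r)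
  smul_add r := map_add (QuotientAddGroup.map N N (LeftModule.smulHom r) (hN r))
  add_smul := by
    rintro r s ⟨x⟩
    exact congrArg (QuotientAddGroup.mk (s := N)) (LeftModule.add_smul r s x)
  mul_smul := by
    rintro r s ⟨x⟩
    exact congrArg (QuotientAddGroup.mk (s := N)) (LeftModule.mul_smul r s x)

/-- The quotient of a unitary module by a submodule. -/
def quotient (M : UnitaryMod R) (N : AddSubgroup M.carrier)
    (hN : ∀ (r : R), ∀ x ∈ N, r • x ∈ N) : UnitaryMod R :=
  @UnitaryMod.mk R _ (M.carrier ⧸ N) _ (quotientLeftModule N hN) <| by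
    let := quotientLeftModule N hN
    refine eq_top_iff.mpr ?_
    rintro ⟨x⟩ -
    have hx : x ∈ AddSubgroup.closure {x : M.carrier | ∃ (r : R) (m : M.carrier), x = r • m} := by
      rw [show AddSubgroup.closure {x : M.carrier | ∃ (r : R) (m : M.carrier), x = r • m} = ⊤
        from M.unitary]; trivial
    refine (AddSubgroup.closure_le (K := (AddSubgroup.closure
      {x : M.carrier ⧸ N | ∃ (r : R) (m : M.carrier ⧸ N), x = r • m}).comap
        (QuotientAddGroup.mk' N))).mpr ?_ hx
    rintro _ ⟨r, m, rfl⟩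
    exact AddSubgroup.subset_closure ⟨r, QuotientAddGroup.mk m, rfl⟩

/-- A submodule is everything if the zero map is the only morphism that vanishes on it. -/
theorem eq_top_of_forall_hom {M : UnitaryMod R} (N : AddSubgroup M.carrier)
    (hN : ∀ (r : R), ∀ x ∈ N, r • x ∈ N)
    (h : ∀ (Q : UnitaryMod R) (g : M ⟶ Q), (∀ x ∈ N, toHom g x = 0) → g = 0) : N = ⊤ := by
  refine eq_top_iff.mpr fun x _ => ?_
  have := h (M.quotient N hN) (ofHom (QuotientAddGroup.mk' N) fun _ _ => rfl) fun x hx =>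
    (QuotientAddGroup.eq_zero_iff x).mpr hx
  have hx := congrArg (fun f => toHom f x) this
  exact (QuotientAddGroup.eq_zero_iff x).mp hx

theorem range_smul_mem {M N : UnitaryMod R} (f : M ⟶ N) (r : R) (x : N.carrier)
    (hx : x ∈ (toHom f).range) : r • x ∈ (toHom f).range := by
  obtain ⟨y, rfl⟩ := hx
  exact ⟨r • y, toHom_smul f r y⟩

/-- Any morphism that kills the range is zero, in particular the projection to the quotient by it.
Projectivity in `RMod` thereby becomes lifting along surjections. -/
theorem surjective_of_epi {M N : UnitaryMod R} (f : M ⟶ N) [Epi f] :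
    Function.Surjective (toHom f) := by
  refine AddMonoidHom.range_eq_top.mp (eq_top_of_forall_hom _ (range_smul_mem f) fun Q g hg => ?_)
  rw [← cancel_epi f]
  ext x
  exact hg _ ⟨x, rfl⟩

theorem epi_of_surjective {M N : UnitaryMod R} (f : M ⟶ N)
    (hf : Function.Surjective (toHom f)) : Epi f where
  left_cancellation g h hgh := by
    ext y
    obtain ⟨x, rfl⟩ := hf y
    exact congrArg (fun k => toHom k x) hgh

/-! ### The left ideals Re and the dual basis lemma -/

/-- The left ideal `Re`. -/
def principalIdeal (e : R) : AddSubgroup R where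
  carrier := {r | r * e = r}
  zero_mem' := zero_mul _
  add_mem' {a b} (ha : _ = _) (hb : _ = _) := by
    change (a + b) * e = a + b
    rw [add_mul, ha, hb]
  neg_mem' {a} (ha : _ = _) := by
    change -a * e = -a
    rw [neg_mul, ha]

instance (e : R) : LeftModule R (principalIdeal e) where
  smul r x := ⟨r * x.1, by
    change r * x.1 * e = r * x.1
    rw [mul_assoc, show x.1 * e = x.1 from x.2]⟩
  smul_add r x y := Subtype.ext (mul_add r x.1 y.1)
  add_smul r s x := Subtype.ext (add_mul r s x.1)
  mul_smul r s x := Subtype.ext (mul_assoc r s x.1)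

/-- The left ideal `Re`, as a unitary module. -/
def principal (hR : HasLocalUnits R) (e : {e : R // IsIdempotentElem e}) : UnitaryMod R where
  carrier := principalIdeal e.1
  unitary := IsUnitaryModule.of_smul_eq fun x => by
    obtain ⟨f, hf⟩ := hR.exists_idempotent {x.1}
    exact ⟨f.1, Subtype.ext (hf x.1 (by simp)).1⟩

variable (hR : HasLocalUnits R)

/-- The inclusion of the left ideal `Re` into `R`. -/
def principalVal (e : {e : R // IsIdempotentElem e}) : (principal hR e).carrier →+ R :=
  AddSubgroup.subtype _

theorem principalVal_injective (e : {e : R // IsIdempotentElem e}) :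
    Function.Injective (principalVal hR e) := Subtype.val_injective

@[simp]
theorem principalVal_mul (e : {e : R // IsIdempotentElem e}) (x : (principal hR e).carrier) :
    principalVal hR e x * e.1 = principalVal hR e x := x.2

/-- The element `r` of `Re`, where `re = r`. -/
def principalMk (e : {e : R // IsIdempotentElem e}) (r : R) (hr : r * e.1 = r) :
    (principal hR e).carrier := ⟨r, hr⟩

/-- The generator `e` of `Re`. -/
def gen (e : {e : R // IsIdempotentElem e}) : (principal hR e).carrier :=
  principalMk hR e e.1 e.2

@[simp]
theorem principalVal_gen (e : {e : R // IsIdempotentElem e}) :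
    principalVal hR e (gen hR e) = e.1 := rfl

theorem principalVal_smul_gen (e : {e : R // IsIdempotentElem e}) (x : (principal hR e).carrier) :
    principalVal hR e x • gen hR e = x :=
  principalVal_injective hR e (principalVal_mul hR e x)

/-- The morphism `Re ⟶ M` given by `r ↦ r • x`. -/
def fromPrincipal (e : {e : R // IsIdempotentElem e}) {M : UnitaryMod R} (x : M.carrier) :
    principal hR e ⟶ M :=
  ofHom ((LeftModule.toSpan x).comp (principalVal hR e)) fun r _ => LeftModule.mul_smul r _ x

@[simp]
theorem fromPrincipal_apply (e : {e : R // IsIdempotentElem e}) {M : UnitaryMod R} (x : M.carrier)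
    (r : (principal hR e).carrier) :
    toHom (fromPrincipal hR e x) r = principalVal hR e r • x := rfl

theorem fromPrincipal_comp (e : {e : R // IsIdempotentElem e}) {M N : UnitaryMod R}
    (x : M.carrier) (f : M ⟶ N) :
    fromPrincipal hR e x ≫ f = fromPrincipal hR e (toHom f x) := by
  ext r
  simp

theorem fromPrincipal_add (e : {e : R // IsIdempotentElem e}) {M : UnitaryMod R}
    (x y : M.carrier) :
    fromPrincipal hR e (x + y) = fromPrincipal hR e x + fromPrincipal hR e y := by
  ext r
  exact LeftModule.smul_add _ _ _

theorem fromPrincipal_gen (e : {e : R // IsIdempotentElem e}) :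
    fromPrincipal hR e (gen hR e) = 𝟙 _ := by
  ext r
  exact principalVal_smul_gen hR e r

theorem principal_isFG (e : {e : R // IsIdempotentElem e}) :
    IsFGModule R (principal hR e).carrier :=
  ⟨{gen hR e}, fun N hN h => eq_top_iff.mpr fun x _ => by
    rw [← principalVal_smul_gen hR e x]
    exact hN _ _ (h _ (by simp))⟩

instance principal_projective (e : {e : R // IsIdempotentElem e}) :
    Projective (principal hR e) where
  factors {M N} f p _ := by
    obtain ⟨m, hm⟩ := surjective_of_epi p (toHom f (gen hR e))
    refine ⟨fromPrincipal hR e m, ?_⟩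
    rw [fromPrincipal_comp, hm, ← fromPrincipal_comp, fromPrincipal_gen, Category.id_comp]

instance {ι : Type u} (M : ι → Type u) [∀ i, AddCommGroup (M i)] [∀ i, LeftModule R (M i)] :
    LeftModule R (∀ i, M i) where
  smul r v i := r • v i
  smul_add r v w := funext fun i => LeftModule.smul_add r (v i) (w i)
  add_smul r s v := funext fun i => LeftModule.add_smul r s (v i)
  mul_smul r s v := funext fun i => LeftModule.mul_smul r s (v i)

/-- The product of finitely many copies of a unitary module. -/
def pi (ι : Type u) [Finite ι] (M : UnitaryMod R) : UnitaryMod R where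
  carrier := ι → M.carrier
  unitary := IsUnitaryModule.of_smul_eq fun v => by
    classical
    have := Fintype.ofFinite ι
    obtain ⟨e, -, he⟩ := M.unitary.exists_idempotent hR ∅ (Finset.univ.image v)
    exact ⟨e.1, funext fun i => he _ (by simp)⟩

/-- The projections of a finite power of a unitary module. -/
def piProj {ι : Type u} [Finite ι] (M : UnitaryMod R) (i : ι) : pi hR ι M ⟶ M :=
  ofHom (M := pi hR ι M) (Pi.evalAddMonoidHom (fun _ : ι => M.carrier) i) fun _ _ => rfl

/-- A finitely generated projective unitary module has a finite dual basis. -/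
theorem exists_dualBasis (M : UnitaryMod R) (hM : IsFGModule R M.carrier) [Projective M] :
    ∃ (e : {e : R // IsIdempotentElem e}) (ι : Type u) (_ : Fintype ι) (x : ι → M.carrier)
      (φ : ι → (M ⟶ principal hR e)), ∑ i, φ i ≫ fromPrincipal hR e (x i) = 𝟙 M := by
  classical
  obtain ⟨X, hX⟩ := hM
  obtain ⟨e, -, he⟩ := M.unitary.exists_idempotent hR ∅ X
  -- One e fixes all generators, so a finite power of a single Re covers M; a section of this cover,
  -- which exists by projectivity, gives the dual basis.
  let p : pi hR X (principal hR e) ⟶ M :=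
    ∑ x : X, piProj hR (principal hR e) x ≫ fromPrincipal hR e x.1
  have : Epi p := epi_of_surjective p <| AddMonoidHom.range_eq_top.mp <|
    hX _ (range_smul_mem p) fun x hx => by
      let v : X → (principal hR e).carrier := Pi.single ⟨x, hx⟩ (gen hR e)
      refine ⟨v, (toHom_sum _ _ _).trans ((Finset.sum_eq_single ⟨x, hx⟩ ?_ ?_).trans ?_)⟩
      · intro y _ hy
        change toHom (fromPrincipal hR e y.1) (v y) = 0
        rw [show v y = 0 from Pi.single_eq_of_ne hy _, map_zero]
      · simp
      · change toHom (fromPrincipal hR e x) (v ⟨x, hx⟩) = x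
        rw [show v ⟨x, hx⟩ = gen hR e from Pi.single_eq_same _ _]
        exact he x hx
  refine ⟨e, X, inferInstance, fun x => x.1,
    fun x => Projective.factorThru (𝟙 M) p ≫ piProj hR _ x, ?_⟩
  simp only [Category.assoc]
  rw [← Preadditive.comp_sum]
  exact Projective.factorThru_comp (𝟙 M) p

end UnitaryMod

/-! ### Additive presheaves on `proj R` -/

namespace FGProjMod

open UnitaryMod hiding principal gen fromPrincipal fromPrincipal_comp fromPrincipal_add
  fromPrincipal_gen exists_dualBasis

variable {R : Type u} [NonUnitalRing R] (hR : HasLocalUnits R)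

/-- The left ideal `Re`, as an object of `proj R`. -/
abbrev principal (e : {e : R // IsIdempotentElem e}) : FGProjMod R :=
  ⟨UnitaryMod.principal hR e, principal_isFG hR e, principal_projective hR e⟩

/-- The generator `e` of `Re`. -/
abbrev gen (e : {e : R // IsIdempotentElem e}) : (principal hR e).obj.carrier :=
  UnitaryMod.gen hR e

/-- The morphism `Re ⟶ M` given by `r ↦ r • x`. -/
def fromPrincipal (e : {e : R // IsIdempotentElem e}) {M : FGProjMod R} (x : M.obj.carrier) :
    principal hR e ⟶ M :=
  ObjectProperty.homMk (UnitaryMod.fromPrincipal hR e x)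

theorem fromPrincipal_comp (e : {e : R // IsIdempotentElem e}) {M N : FGProjMod R}
    (x : M.obj.carrier) (f : M ⟶ N) :
    fromPrincipal hR e x ≫ f = fromPrincipal hR e (toHom f.hom x) :=
  ObjectProperty.hom_ext _ (UnitaryMod.fromPrincipal_comp hR e x f.hom)

theorem fromPrincipal_add (e : {e : R // IsIdempotentElem e}) {M : FGProjMod R}
    (x y : M.obj.carrier) :
    fromPrincipal hR e (x + y) = fromPrincipal hR e x + fromPrincipal hR e y :=
  ObjectProperty.hom_ext _ (UnitaryMod.fromPrincipal_add hR e x y)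

theorem fromPrincipal_gen (e : {e : R // IsIdempotentElem e}) :
    fromPrincipal hR e (gen hR e) = 𝟙 _ :=
  ObjectProperty.hom_ext _ (UnitaryMod.fromPrincipal_gen hR e)

/-- The action of a contravariant functor on a morphism. -/
def act (T : (FGProjMod R)ᵒᵖ ⥤ AddCommGrpCat.{u}) {P Q : FGProjMod R} (f : P ⟶ Q) :
    T.obj (.op Q) →+ T.obj (.op P) := (T.map f.op).hom

section

variable (T : (FGProjMod R)ᵒᵖ ⥤ AddCommGrpCat.{u}) {P Q Q' : FGProjMod R}

theorem act_id (t : T.obj (.op P)) : act T (𝟙 P) t = t := by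
  simp [act]

theorem act_act (f : P ⟶ Q) (g : Q ⟶ Q') (t : T.obj (.op Q')) :
    act T f (act T g t) = act T (f ≫ g) t := by
  simp [act]

theorem act_add [T.Additive] (f g : P ⟶ Q) (t : T.obj (.op Q)) :
    act T (f + g) t = act T f t + act T g t := by
  simp [act, op_add, T.map_add]

theorem act_sum [T.Additive] {ι : Type*} (s : Finset ι) (f : ι → (P ⟶ Q)) (t : T.obj (.op Q)) :
    act T (∑ i ∈ s, f i) t = ∑ i ∈ s, act T (f i) t :=
  map_sum (AddMonoidHom.mk' (fun f : P ⟶ Q => act T f t) fun f g => act_add T f g t) f s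

theorem app_act {T T' : (FGProjMod R)ᵒᵖ ⥤ AddCommGrpCat.{u}} (α : T ⟶ T') (f : P ⟶ Q)
    (t : T.obj (.op Q)) :
    (α.app (.op P)).hom (act T f t) = act T' f ((α.app (.op Q)).hom t) :=
  congrArg (fun k => k.hom t) (α.naturality f.op)

end

/-- A finite dual basis of a finitely generated projective module. -/
theorem exists_dualBasis (M : FGProjMod R) :
    ∃ (e : {e : R // IsIdempotentElem e}) (ι : Type u) (_ : Fintype ι) (x : ι → M.obj.carrier)
      (φ : ι → (M ⟶ principal hR e)), ∑ i, φ i ≫ fromPrincipal hR e (x i) = 𝟙 M := by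
  have := M.property.2
  obtain ⟨e, ι, hι, x, φ, h⟩ := UnitaryMod.exists_dualBasis hR M.obj M.property.1
  refine ⟨e, ι, hι, x, fun i => ObjectProperty.homMk (φ i), ObjectProperty.hom_ext _ ?_⟩
  exact ((ObjectProperty.ι _).map_sum _ _).trans h

/-- A natural transformation between additive functors on `proj R` is invertible if its
components at the left ideals `Re` are. -/
theorem isIso_of_principal {T T' : (FGProjMod R)ᵒᵖ ⥤ AddCommGrpCat.{u}} [T.Additive] [T'.Additive]
    (α : T ⟶ T')
    (h : ∀ e, Function.Bijective (α.app (.op (principal hR e))).hom) : IsIso α := by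
  have : ∀ Q : (FGProjMod R)ᵒᵖ, IsIso (α.app Q) := by
    intro Q
    rw [ConcreteCategory.isIso_iff_bijective]
    obtain ⟨e, ι, _, x, φ, hφ⟩ := exists_dualBasis hR Q.unop
    -- Applying T to the dual basis identity rebuilds t from finitely many elements of T(Re), so
    -- both injectivity and surjectivity pass from Re to Q.
    have key : ∀ (T : (FGProjMod R)ᵒᵖ ⥤ AddCommGrpCat.{u}) [T.Additive] (t : T.obj Q),
        t = ∑ i, act T (φ i) (act T (fromPrincipal hR e (x i)) t) := fun T _ t => by
      refine (act_id T t).symm.trans ?_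
      rw [← hφ, act_sum]
      simp only [act_act]
    constructor
    · refine (injective_iff_map_eq_zero (α.app Q).hom).mpr fun t ht => ?_
      rw [key T t]
      refine Finset.sum_eq_zero fun i _ => ?_
      have : act T (fromPrincipal hR e (x i)) t = 0 := by
        refine (injective_iff_map_eq_zero (α.app (.op (principal hR e))).hom).mp (h e).1 _ ?_
        rw [app_act]
        exact (congrArg _ ht).trans (map_zero _)
      rw [this, map_zero]
    · intro s
      choose t ht using fun i => (h e).2 (act T' (fromPrincipal hR e (x i)) s)
      refine ⟨∑ i, act T (φ i) (t i), ?_⟩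
      refine (map_sum (α.app Q).hom _ _).trans ?_
      rw [key T' s]
      refine Finset.sum_congr rfl fun i _ => ?_
      rw [← ht i]
      exact app_act α (φ i) (t i)
  exact NatIso.isIso_of_isIso_app α

/-! ### The module realizing an additive presheaf -/

section Realization

variable (T : (FGProjMod R)ᵒᵖ ⥤ AddCommGrpCat.{u})

/-- The family of the elements `T(r ↦ r • q)(t)` of `T(Re)`, for `e` an idempotent of `R`. -/
def family {Q : FGProjMod R} (t : T.obj (.op Q)) (q : Q.obj.carrier) :
    ∀ e : {e : R // IsIdempotentElem e}, T.obj (.op (principal hR e)) :=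
  fun e => act T (fromPrincipal hR e q) t

theorem family_add_left {Q : FGProjMod R} (t t' : T.obj (.op Q)) (q : Q.obj.carrier) :
    family hR T (t + t') q = family hR T t q + family hR T t' q :=
  funext fun _ => map_add _ _ _

theorem family_act {P Q : FGProjMod R} (f : P ⟶ Q) (t : T.obj (.op Q)) (p : P.obj.carrier) :
    family hR T (act T f t) p = family hR T t (toHom f.hom p) :=
  funext fun e => by
    rw [family, family, act_act, fromPrincipal_comp]

/-- A family is recovered from its component at any e fixing q. For T = Hom(-, M) the family of t
and q is e ↦ e • t(q), so families model the elements of M inside the product of the eM, and no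
colimit over idempotents is needed. -/
theorem family_eq_gen {Q : FGProjMod R} (t : T.obj (.op Q)) (q : Q.obj.carrier)
    (e : {e : R // IsIdempotentElem e}) (he : e.1 • q = q) :
    family hR T (family hR T t q e) (gen hR e) = family hR T t q :=
  (family_act hR T (fromPrincipal hR e q) t (gen hR e)).trans (congrArg _ he)

/-- An idempotent that is a right unit of a given element. -/
noncomputable def rightUnit (r : R) : {e : R // IsIdempotentElem e} :=
  (hR.exists_idempotent {r}).choose

theorem mul_rightUnit (r : R) : r * (rightUnit hR r).1 = r :=
  ((hR.exists_idempotent {r}).choose_spec r (by simp)).2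

/-- The action of `R` on families. -/
noncomputable def smulFamily (r : R) :
    (∀ e : {e : R // IsIdempotentElem e}, T.obj (.op (principal hR e))) →+
      ∀ e : {e : R // IsIdempotentElem e}, T.obj (.op (principal hR e)) where
  -- With f a right unit of r, the model is e(rm) = (er)(fm): only the component of m at f matters,
  -- and r is read as an element of Rf.
  toFun m := family hR T (m (rightUnit hR r)) (Q := principal hR (rightUnit hR r))
    (principalMk hR (rightUnit hR r) r (mul_rightUnit hR r))
  map_zero' := funext fun _ => map_zero _
  map_add' _ _ := family_add_left hR T _ _ _

theorem smulFamily_family (r : R) {Q : FGProjMod R} (t : T.obj (.op Q)) (q : Q.obj.carrier) :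
    smulFamily hR T r (family hR T t q) = family hR T t (r • q) :=
  family_act hR T _ _ _

variable [T.Additive]

theorem family_add_right {Q : FGProjMod R} (t : T.obj (.op Q)) (q q' : Q.obj.carrier) :
    family hR T t (q + q') = family hR T t q + family hR T t q' :=
  funext fun e => by
    simp only [family, Pi.add_apply]
    rw [fromPrincipal_add, act_add]

theorem family_neg_right {Q : FGProjMod R} (t : T.obj (.op Q)) (q : Q.obj.carrier) :
    family hR T t (-q) = -family hR T t q :=
  map_neg (AddMonoidHom.mk' (family hR T t) (family_add_right hR T t)) q

/-- The group of families coming from the elements of the values of an additive functor. -/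
def families : AddSubgroup (∀ e : {e : R // IsIdempotentElem e}, T.obj (.op (principal hR e))) where
  carrier := {m | ∃ (Q : FGProjMod R) (t : T.obj (.op Q)) (q : Q.obj.carrier),
    m = family hR T t q}
  zero_mem' := by
    obtain ⟨e, -⟩ := hR.exists_idempotent ∅
    exact ⟨principal hR e, 0, 0, funext fun _ => (map_zero _).symm⟩
  add_mem' := by
    classical
    rintro _ _ ⟨Q, t, q, rfl⟩ ⟨Q', t', q', rfl⟩
    obtain ⟨A, hA⟩ := Q.obj.unitary.exists_finset_smul_eq q
    obtain ⟨A', hA'⟩ := Q'.obj.unitary.exists_finset_smul_eq q'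
    -- An e fixing both q and q' moves the two families to the same object Re and the same
    -- generator, where addition takes place in T(Re).
    obtain ⟨e, he⟩ := hR.exists_idempotent (A ∪ A')
    have hq := hA e.1 fun a ha => (he a (by simp [ha])).1
    have hq' := hA' e.1 fun a ha => (he a (by simp [ha])).1
    refine ⟨principal hR e, family hR T t q e + family hR T t' q' e, gen hR e, ?_⟩
    rw [family_add_left, family_eq_gen hR T t q e hq, family_eq_gen hR T t' q' e hq']
  neg_mem' := by
    rintro _ ⟨Q, t, q, rfl⟩
    exact ⟨Q, t, -q, (family_neg_right hR T t q).symm⟩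

noncomputable instance : LeftModule R (families hR T) where
  smul r m := ⟨smulFamily hR T r m.1, by
    obtain ⟨_, Q, t, q, rfl⟩ := m
    exact ⟨Q, t, r • q, smulFamily_family hR T r t q⟩⟩
  smul_add r m m' := Subtype.ext (map_add (smulFamily hR T r) m.1 m'.1)
  add_smul r s m := by
    obtain ⟨_, Q, t, q, rfl⟩ := m
    refine Subtype.ext ?_
    change smulFamily hR T (r + s) _ = smulFamily hR T r _ + smulFamily hR T s _
    rw [smulFamily_family, smulFamily_family, smulFamily_family, LeftModule.add_smul,
      family_add_right]
  mul_smul r s m := by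
    obtain ⟨_, Q, t, q, rfl⟩ := m
    refine Subtype.ext ?_
    change smulFamily hR T (r * s) _ = smulFamily hR T r (smulFamily hR T s _)
    rw [smulFamily_family, smulFamily_family, smulFamily_family, LeftModule.mul_smul]

/-- The unitary module that represents an additive functor on `proj R`. -/
noncomputable def realization : UnitaryMod R where
  carrier := families hR T
  unitary := IsUnitaryModule.of_smul_eq fun m => by
    obtain ⟨_, Q, t, q, rfl⟩ := m
    obtain ⟨e, he⟩ := Q.obj.exists_idempotent hR q
    refine ⟨e.1, Subtype.ext ?_⟩
    change smulFamily hR T e.1 _ = _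
    rw [smulFamily_family, he]

/-- The morphism to the realization given by an element of the functor. -/
noncomputable def toRealization {Q : FGProjMod R} (t : T.obj (.op Q)) :
    Q.obj ⟶ realization hR T :=
  ofHom (N := realization hR T)
    (AddMonoidHom.mk' (fun q => (⟨family hR T t q, Q, t, q, rfl⟩ : families hR T))
      fun q q' => Subtype.ext (family_add_right hR T t q q'))
    fun r q => Subtype.ext (smulFamily_family hR T r t q).symm

end Realization

/-! ### Restricted Yoneda: comparison and faithfulness -/

variable (R) in
/-- The functor that sends a unitary module to the restriction of its Yoneda presheaf to
`proj R`. -/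
noncomputable def restrictedYoneda :
    UnitaryMod R ⥤ (FGProjMod R)ᵒᵖ ⥤ AddCommGrpCat.{u} :=
  preadditiveYoneda ⋙ (Functor.whiskeringLeft _ _ _).obj (ObjectProperty.ι _).op

instance (M : UnitaryMod R) : ((restrictedYoneda R).obj M).Additive :=
  inferInstanceAs ((ObjectProperty.ι _).op ⋙ preadditiveYoneda.obj M).Additive

/-- The comparison of an additive functor with the presheaf of its realization. -/
noncomputable def comparison (T : (FGProjMod R)ᵒᵖ ⥤ AddCommGrpCat.{u}) [T.Additive] :
    T ⟶ (restrictedYoneda R).obj (realization hR T) where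
  app Q := AddCommGrpCat.ofHom
    (AddMonoidHom.mk' (fun t : T.obj Q => (toRealization hR T (Q := Q.unop) t :
      Q.unop.obj ⟶ realization hR T)) fun t t' =>
        UnitaryMod.hom_ext fun q => Subtype.ext (family_add_left hR T (Q := Q.unop) t t' q))
  naturality _ _ f := AddCommGrpCat.hom_ext <| AddMonoidHom.ext fun t =>
    UnitaryMod.hom_ext fun q => Subtype.ext (family_act hR T f.unop t q)

theorem isIso_comparison (T : (FGProjMod R)ᵒᵖ ⥤ AddCommGrpCat.{u}) [T.Additive] :
    IsIso (comparison hR T) := by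
  refine isIso_of_principal hR _ fun e => ⟨fun t t' h => ?_, fun φ => ?_⟩
  -- Evaluating at the generator and taking the component at e returns t, because r ↦ r • e is the
  -- identity of Re.
  · have h : toRealization hR T (Q := principal hR e) t = toRealization hR T t' := h
    have h : family hR T (Q := principal hR e) t (gen hR e) e = family hR T t' (gen hR e) e :=
      congrFun (congrArg (fun f => (toHom f (gen hR e) : families hR T).1) h) e
    simpa only [family, fromPrincipal_gen, act_id] using h
  · change UnitaryMod.principal hR e ⟶ realization hR T at φ
    obtain ⟨Q, t, q, hq⟩ := (toHom φ (UnitaryMod.gen hR e) : families hR T).2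
    -- A morphism out of Re is determined by the image of the generator; the component of that image
    -- at e is the preimage.
    refine ⟨family hR T t q e, UnitaryMod.hom_ext fun r => Subtype.ext ?_⟩
    have h : toHom φ r = principalVal hR e r • toHom φ (UnitaryMod.gen hR e) :=
      (congrArg (toHom φ) (principalVal_smul_gen hR e r).symm).trans (toHom_smul _ _ _)
    have h' : (toHom φ r : families hR T).1 =
        smulFamily hR T (principalVal hR e r) (toHom φ (UnitaryMod.gen hR e) : families hR T).1 :=
      congrArg Subtype.val h
    refine Eq.trans ?_ h'.symm
    rw [hq, smulFamily_family]
    exact family_act hR T (fromPrincipal hR e q) t r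

/-- The map on morphisms given by a transformation of restricted Yoneda presheaves. -/
noncomputable def mapHom {M N : UnitaryMod R}
    (α : (restrictedYoneda R).obj M ⟶ (restrictedYoneda R).obj N) (Q : FGProjMod R) : (Q.obj ⟶ M) →+ (Q.obj ⟶ N) :=
  (α.app (.op Q)).hom

theorem mapHom_comp {M N : UnitaryMod R}
    (α : (restrictedYoneda R).obj M ⟶ (restrictedYoneda R).obj N) {P Q : FGProjMod R}
    (f : P ⟶ Q) (g : Q.obj ⟶ M) : mapHom α P (f.hom ≫ g) = f.hom ≫ mapHom α Q g :=
  app_act α f g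

/-- Every x in M is fixed by some e, hence is the image of the generator under a morphism Re ⟶ M. -/
theorem restrictedYoneda_faithful (hR : HasLocalUnits R) : (restrictedYoneda R).Faithful where
  map_injective {M N f g} h := by
    ext x
    obtain ⟨e, he⟩ := M.exists_idempotent hR x
    have h : UnitaryMod.fromPrincipal hR e x ≫ f = UnitaryMod.fromPrincipal hR e x ≫ g :=
      congrArg (fun α => mapHom α (principal hR e) (UnitaryMod.fromPrincipal hR e x)) h
    have h := congrArg (fun f => toHom f (UnitaryMod.gen hR e)) h
    simpa [he] using h

/-! ### Restricted Yoneda: fullness by gluing local maps -/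

section Full

variable {M N : UnitaryMod R} (α : (restrictedYoneda R).obj M ⟶ (restrictedYoneda R).obj N)

/-- The additive map given by a transformation of restricted Yoneda presheaves at `Re`. -/
noncomputable def localMap (e : {e : R // IsIdempotentElem e}) : M.carrier →+ N.carrier :=
  AddMonoidHom.mk' (fun x => toHom (mapHom α (principal hR e) (UnitaryMod.fromPrincipal hR e x))
    (gen hR e)) fun x y => by
      rw [UnitaryMod.fromPrincipal_add]
      exact congrArg (fun f => toHom f (gen hR e)) (map_add (mapHom α (principal hR e)) _ _)

/-- This is naturality of α along r ↦ r • q. It shows that `localMap` at e plays the role of x ↦ e •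
φ(x) for the morphism φ to be constructed. -/
theorem localMap_apply (e : {e : R // IsIdempotentElem e}) {Q : FGProjMod R} (g : Q.obj ⟶ M)
    (q : Q.obj.carrier) :
    localMap hR α e (toHom g q) = e.1 • toHom (mapHom α Q g) q := by
  change toHom (mapHom α (principal hR e) (UnitaryMod.fromPrincipal hR e (toHom g q)))
    (gen hR e) = _
  rw [← UnitaryMod.fromPrincipal_comp]
  exact (congrArg (fun f => toHom f (gen hR e)) (mapHom_comp α (fromPrincipal hR e q) g)).trans
    (toHom_smul _ _ _)

/-- Apply `localMap_apply` to the morphism Rf ⟶ M given by x, at the element r = rf of Rf; then e is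
absorbed because er = r. -/
theorem localMap_smul (e f : {e : R // IsIdempotentElem e}) (r : R) (her : e.1 * r = r)
    (hrf : r * f.1 = r) (x : M.carrier) :
    localMap hR α e (r • x) = r • localMap hR α f x := by
  refine (localMap_apply hR α e (Q := principal hR f) (UnitaryMod.fromPrincipal hR f x)
    (principalMk hR f r hrf)).trans ?_
  rw [← toHom_smul]
  change _ = r • toHom _ _
  rw [← toHom_smul]
  refine congrArg _ (principalVal_injective hR f ?_)
  exact her.trans hrf.symm

theorem localMap_eq_of_mul_eq (e f : {e : R // IsIdempotentElem e}) (h : f.1 * e.1 = e.1)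
    (x : M.carrier) (hx : e.1 • x = x) : localMap hR α f x = localMap hR α e x := by
  have h₁ := localMap_smul hR α f e e.1 h e.2 x
  have h₂ := localMap_smul hR α e e e.1 e.2 e.2 x
  rw [hx] at h₁ h₂
  rw [h₁, ← h₂]

/-- Both sides equal the value at an idempotent that is a two-sided unit for e and f. -/
theorem localMap_eq (e f : {e : R // IsIdempotentElem e}) (x : M.carrier)
    (he : e.1 • x = x) (hf : f.1 • x = x) : localMap hR α e x = localMap hR α f x := by
  classical
  obtain ⟨g, hg⟩ := hR.exists_idempotent {e.1, f.1}
  rw [← localMap_eq_of_mul_eq hR α e g (hg _ (by simp)).1 x he,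
    localMap_eq_of_mul_eq hR α f g (hg _ (by simp)).1 x hf]

/-- By independence of the idempotent, each x may use any e that fixes it. Additivity and linearity
are then checked with one idempotent large enough for all elements involved. -/
theorem exists_hom_eq_localMap :
    ∃ φ : M ⟶ N, ∀ e x, e.1 • x = x → toHom φ x = localMap hR α e x := by
  classical
  choose u hu using M.exists_idempotent hR
  have key : ∀ e x, e.1 • x = x → localMap hR α (u x) x = localMap hR α e x :=
    fun e x he => localMap_eq hR α _ _ x (hu x) he
  let φ : M.carrier →+ N.carrier := AddMonoidHom.mk' (fun x => localMap hR α (u x) x) fun x y => by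
    obtain ⟨e, -, he⟩ := M.unitary.exists_idempotent hR ∅ {x, y}
    have hx := he x (by simp)
    have hy := he y (by simp)
    rw [key e x hx, key e y hy, key e (x + y) (by rw [LeftModule.smul_add, hx, hy]), map_add]
  refine ⟨ofHom φ fun r x => ?_, key⟩
  obtain ⟨f, hf, hx⟩ := M.unitary.exists_idempotent hR {r} {x}
  have hr := hf r (by simp)
  change localMap hR α (u (r • x)) (r • x) = r • localMap hR α (u x) x
  rw [key f x (hx x (by simp)), key f (r • x) (by rw [← LeftModule.mul_smul, hr.1]),
    localMap_smul hR α f f r hr.1 hr.2]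

end Full

theorem restrictedYoneda_full (hR : HasLocalUnits R) : (restrictedYoneda R).Full where
  map_surjective {M N} α := by
    obtain ⟨φ, hφ⟩ := exists_hom_eq_localMap hR α
    refine ⟨φ, NatTrans.ext <| funext fun Q => AddCommGrpCat.hom_ext <| AddMonoidHom.ext
      fun (g : Q.unop.obj ⟶ M) => ?_⟩
    change g ≫ φ = mapHom α Q.unop g
    ext q
    obtain ⟨e, he⟩ := Q.unop.obj.exists_idempotent hR q
    rw [toHom_comp, hφ e _ (by rw [← toHom_smul, he]), localMap_apply, ← toHom_smul, he]

theorem essImage_restrictedYoneda (hR : HasLocalUnits R)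
    (T : (FGProjMod R)ᵒᵖ ⥤ AddCommGrpCat.{u}) :
    (restrictedYoneda R).essImage T ↔ T.Additive := by
  constructor
  · rintro ⟨M, ⟨i⟩⟩
    exact Functor.additive_of_iso i
  · intro _
    have := isIso_comparison hR T
    exact ⟨realization hR T, ⟨(asIso (comparison hR T)).symm⟩⟩

end FGProjMod

/-! ### From `proj` to Morita equivalence -/

/-- Two fully faithful functors with the same essential image have equivalent sources. -/
theorem CategoryTheory.Functor.nonempty_equivalence_of_essImage_eq {C D E : Type*} [Category* C]
    [Category* D] [Category* E] (K : C ⥤ E) (L : D ⥤ E) [K.Full] [K.Faithful] [L.Full]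
    [L.Faithful] (h : K.essImage = L.essImage) : Nonempty (C ≌ D) := by
  have : K.toEssImage.IsEquivalence := { }
  have : L.toEssImage.IsEquivalence := { }
  exact ⟨K.toEssImage.asEquivalence.trans
    ((h ▸ Equivalence.refl : K.essImage.FullSubcategory ≌ L.essImage.FullSubcategory).trans
      L.toEssImage.asEquivalence.symm)⟩

theorem areMoritaEquivalent_of_FGProjMod {R S : Type u} [NonUnitalRing R] [NonUnitalRing S]
    (hR : HasLocalUnits R) (hS : HasLocalUnits S) (F : FGProjMod R ⥤ FGProjMod S)
    [F.IsEquivalence] [F.Additive] : AreMoritaEquivalent R S := by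
  have := FGProjMod.restrictedYoneda_full hR
  have := FGProjMod.restrictedYoneda_faithful hR
  have := FGProjMod.restrictedYoneda_full hS
  have := FGProjMod.restrictedYoneda_faithful hS
  let E := F.asEquivalence.op.congrLeft (E := AddCommGrpCat.{u})
  -- `E.inverse` is precomposition with F. Since F and its inverse are additive, it matches additive
  -- presheaves with additive presheaves, so both essential images consist of the additive ones.
  refine Functor.nonempty_equivalence_of_essImage_eq (FGProjMod.restrictedYoneda R)
    (FGProjMod.restrictedYoneda S ⋙ E.inverse) ?_
  funext T
  refine propext ((FGProjMod.essImage_restrictedYoneda hR T).trans ⟨fun _ => ?_, ?_⟩)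
  · have : F.asEquivalence.functor.Additive := inferInstanceAs F.Additive
    have : (E.functor.obj T).Additive :=
      inferInstanceAs (F.asEquivalence.inverse.op ⋙ T).Additive
    obtain ⟨M, ⟨i⟩⟩ := (FGProjMod.essImage_restrictedYoneda hS (E.functor.obj T)).mpr this
    exact ⟨M, ⟨E.inverse.mapIso i ≪≫ E.unitIso.symm.app T⟩⟩
  · rintro ⟨M, ⟨i⟩⟩
    have : ((FGProjMod.restrictedYoneda S ⋙ E.inverse).obj M).Additive :=
      inferInstanceAs (F.op ⋙ (FGProjMod.restrictedYoneda S).obj M).Additive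
    exact Functor.additive_of_iso i

/-! ### Categorical invariance of finite generation and addition -/

namespace UnitaryMod

variable {R : Type u} [NonUnitalRing R]

/-- Finite generation in categorical terms: every jointly epimorphic family has a finite jointly
epimorphic subfamily. -/
theorem isFGModule_iff (hR : HasLocalUnits R) (M : UnitaryMod R) :
    IsFGModule R M.carrier ↔ ∀ (ι : Type u) (N : ι → UnitaryMod R) (f : ∀ i, N i ⟶ M),
      (∀ (Q : UnitaryMod R) (g h : M ⟶ Q), (∀ i, f i ≫ g = f i ≫ h) → g = h) →
      ∃ s : Finset ι, ∀ (Q : UnitaryMod R) (g h : M ⟶ Q),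
        (∀ i ∈ s, f i ≫ g = f i ≫ h) → g = h := by
  classical
  constructor
  · rintro ⟨X, hX⟩ ι N f hf
    -- Joint epimorphy says that the ranges together generate M; each of the finitely many
    -- generators then needs only finitely many indices.
    have htop : ⨆ i, (toHom (f i)).range = ⊤ := by
      refine eq_top_of_forall_hom _ (fun r x hx => ?_) fun Q g hg => hf Q g 0 fun i => ?_
      · refine (iSup_le (a := (⨆ i, (toHom (f i)).range).comap (LeftModule.smulHom r))
          fun i y hy => ?_) hx
        exact le_iSup (fun i => (toHom (f i)).range) i (range_smul_mem (f i) r y hy)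
      · ext x
        exact hg _ (le_iSup (fun i => (toHom (f i)).range) i ⟨x, rfl⟩)
    have hfin : ∀ x : M.carrier, ∃ s : Finset ι, ∀ (Q : UnitaryMod R) (g h : M ⟶ Q),
        (∀ i ∈ s, f i ≫ g = f i ≫ h) → toHom g x = toHom h x := by
      intro x
      have hx : x ∈ ⨆ i, (toHom (f i)).range := htop ▸ trivial
      refine AddSubgroup.iSup_induction (fun i => (toHom (f i)).range)
        (C := fun x => ∃ s : Finset ι, ∀ (Q : UnitaryMod R) (g h : M ⟶ Q),
          (∀ i ∈ s, f i ≫ g = f i ≫ h) → toHom g x = toHom h x) hx ?_ ?_ ?_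
      · rintro i _ ⟨y, rfl⟩
        exact ⟨{i}, fun Q g h hgh => congrArg (fun k => toHom k y) (hgh i (by simp))⟩
      · exact ⟨∅, fun Q g h _ => by rw [map_zero, map_zero]⟩
      · rintro x y ⟨s, hs⟩ ⟨t, ht⟩
        refine ⟨s ∪ t, fun Q g h hgh => ?_⟩
        rw [map_add, map_add, hs Q g h fun i hi => hgh i (by simp [hi]),
          ht Q g h fun i hi => hgh i (by simp [hi])]
    choose s hs using hfin
    refine ⟨X.biUnion s, fun Q g h hgh => ?_⟩
    have := hX ((toHom g).eqLocus (toHom h)) (fun r x hx => ?_) fun x hx =>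
      hs x Q g h fun i hi => hgh i (Finset.mem_biUnion.mpr ⟨x, hx, hi⟩)
    · ext x
      exact (this ▸ trivial : x ∈ (toHom g).eqLocus (toHom h))
    · change toHom g (r • x) = toHom h (r • x)
      rw [toHom_smul, toHom_smul, show toHom g x = toHom h x from hx]
  · intro H
    -- The test family has one morphism Re ⟶ M through each x in M, with ex = x; the indices of a
    -- finite jointly epimorphic subfamily generate M.
    choose e he using M.exists_idempotent hR
    obtain ⟨s, hs⟩ := H M.carrier (fun x => principal hR (e x))
      (fun x => fromPrincipal hR (e x) x) fun Q g h hgh => by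
        ext x
        simpa [he] using congrArg (fun k => toHom k (gen hR (e x))) (hgh x)
    refine ⟨s, fun N hN hsN => eq_top_of_forall_hom N hN fun Q g hg => hs Q g 0 fun x hx => ?_⟩
    ext r
    exact hg _ (hN _ x (hsN x hx))

/-- The criterion of `isFGModule_iff` mentions only morphisms, so a family over the image of M is
pulled back along the inverse equivalence. -/
theorem isFGModule_functor_obj {S : Type u} [NonUnitalRing S] (hR : HasLocalUnits R)
    (hS : HasLocalUnits S) (E : UnitaryMod R ≌ UnitaryMod S) (M : UnitaryMod R)
    (hM : IsFGModule R M.carrier) : IsFGModule S (E.functor.obj M).carrier := by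
  rw [isFGModule_iff hR] at hM
  rw [isFGModule_iff hS]
  intro ι N f hf
  obtain ⟨s, hs⟩ := hM ι (fun i => E.inverse.obj (N i))
    (fun i => E.inverse.map (f i) ≫ E.unitInv.app M) fun Q g h hgh => by
      refine E.functor.map_injective (hf _ _ _ fun i => ?_)
      have := congrArg E.functor.map (hgh i)
      simpa using this
  refine ⟨s, fun Q g h hgh => ?_⟩
  refine E.inverse.map_injective ((cancel_epi (E.unit.app M)).mp (hs _ _ _ fun i hi => ?_))
  have := congrArg E.inverse.map (hgh i hi)
  simpa using this

theorem isFGModule_of_iso {M N : UnitaryMod R} (i : M ≅ N)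
    (hM : IsFGModule R M.carrier) : IsFGModule R N.carrier := by
  classical
  obtain ⟨X, hX⟩ := hM
  refine ⟨X.image (toHom i.hom), fun L hL hXL => eq_top_iff.mpr fun y _ => ?_⟩
  have h := hX (L.comap (toHom i.hom)) (fun r x hx => ?_) fun x hx =>
    hXL _ (Finset.mem_image_of_mem _ hx)
  · have hy : toHom i.hom (toHom i.inv y) = y := congrArg (fun k => toHom k y) i.inv_hom_id
    rw [← hy]
    exact (h ▸ trivial : toHom i.inv y ∈ L.comap (toHom i.hom))
  · change toHom i.hom (r • x) ∈ L
    rw [toHom_smul]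
    exact hL r _ hx

instance (M N : Type u) [AddCommGroup M] [LeftModule R M] [AddCommGroup N] [LeftModule R N] :
    LeftModule R (M × N) where
  smul r v := (r • v.1, r • v.2)
  smul_add r v w := Prod.ext (LeftModule.smul_add r v.1 w.1) (LeftModule.smul_add r v.2 w.2)
  add_smul r s v := Prod.ext (LeftModule.add_smul r s v.1) (LeftModule.add_smul r s v.2)
  mul_smul r s v := Prod.ext (LeftModule.mul_smul r s v.1) (LeftModule.mul_smul r s v.2)

/-- The product of two unitary modules. -/
def prod (hR : HasLocalUnits R) (M N : UnitaryMod R) : UnitaryMod R where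
  carrier := M.carrier × N.carrier
  unitary := IsUnitaryModule.of_smul_eq fun v => by
    classical
    obtain ⟨A, hA⟩ := M.unitary.exists_finset_smul_eq v.1
    obtain ⟨B, hB⟩ := N.unitary.exists_finset_smul_eq v.2
    obtain ⟨e, he⟩ := hR.exists_idempotent (A ∪ B)
    exact ⟨e.1, Prod.ext (hA _ fun a ha => (he a (by simp [ha])).1)
      (hB _ fun a ha => (he a (by simp [ha])).1)⟩

open Limits in
theorem hasBinaryBiproducts (hR : HasLocalUnits R) : HasBinaryBiproducts (UnitaryMod R) where
  has_binary_biproduct M N :=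
    hasBinaryBiproduct_of_total
      { pt := prod hR M N
        fst := ofHom (M := prod hR M N) (AddMonoidHom.fst M.carrier N.carrier) fun _ _ => rfl
        snd := ofHom (M := prod hR M N) (AddMonoidHom.snd M.carrier N.carrier) fun _ _ => rfl
        inl := ofHom (N := prod hR M N) (AddMonoidHom.inl M.carrier N.carrier) fun r _ =>
          Prod.ext rfl (LeftModule.smul_zero' r).symm
        inr := ofHom (N := prod hR M N) (AddMonoidHom.inr M.carrier N.carrier) fun r _ =>
          Prod.ext (LeftModule.smul_zero' r).symm rfl
        inl_fst := rfl
        inl_snd := rfl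
        inr_fst := rfl
        inr_snd := rfl } (hom_ext fun v =>
          Prod.ext (add_zero v.1) (zero_add v.2))

/-- Biproducts determine the addition of morphisms, and an equivalence preserves binary products.
Hence Morita equivalence need not assume additivity. -/
theorem functor_additive {S : Type u} [NonUnitalRing S] (hR : HasLocalUnits R)
    (E : UnitaryMod R ≌ UnitaryMod S) : E.functor.Additive := by
  have := hasBinaryBiproducts hR
  exact Functor.additive_of_preserves_binary_products _

end UnitaryMod

/-! ### Restricting equivalences to projective modules -/

theorem exists_equivalence_ProjMod {R S : Type u} [NonUnitalRing R] [NonUnitalRing S]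
    (hR : HasLocalUnits R) (hS : HasLocalUnits S) (E : UnitaryMod R ≌ UnitaryMod S) :
    ∃ F : ProjMod R ⥤ ProjMod S, F.IsEquivalence ∧ F.Additive ∧
      ∀ P : ProjMod R, IsFGModule R P.obj.carrier ↔ IsFGModule S (F.obj P).obj.carrier := by
  have := UnitaryMod.functor_additive hR E
  have : ObjectProperty.IsClosedUnderIsomorphisms (fun M : UnitaryMod S => Projective M) :=
    ⟨fun i h => Projective.of_iso i h⟩
  let E' : ProjMod R ≌ ProjMod S := E.congrFullSubcategory
    (funext fun M => propext (E.map_projective_iff M))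
  refine ⟨E'.functor, inferInstance, ⟨ObjectProperty.hom_ext _ E.functor.map_add⟩, fun P =>
    ⟨UnitaryMod.isFGModule_functor_obj hR hS E P.obj, fun h => ?_⟩⟩
  exact UnitaryMod.isFGModule_of_iso (E.unitIso.symm.app P.obj)
    (UnitaryMod.isFGModule_functor_obj hS hR E.symm _ h)

theorem exists_equivalence_FGProjMod {R S : Type u} [NonUnitalRing R] [NonUnitalRing S]
    (F : ProjMod R ⥤ ProjMod S) [F.IsEquivalence] [F.Additive]
    (hF : ∀ P : ProjMod R,
      IsFGModule R P.obj.carrier ↔ IsFGModule S (F.obj P).obj.carrier) :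
    ∃ G : FGProjMod R ⥤ FGProjMod S, G.IsEquivalence ∧ G.Additive := by
  let I : FGProjMod R ⥤ ProjMod R := ObjectProperty.ιOfLE fun _ h => h.2
  let G : FGProjMod R ⥤ FGProjMod S := ObjectProperty.lift _ (I ⋙ F ⋙ ObjectProperty.ι _)
    fun P => ⟨(hF (I.obj P)).mp P.property.1, (F.obj (I.obj P)).property⟩
  have : I.Full := ObjectProperty.full_ιOfLE _
  have : I.Faithful := ObjectProperty.faithful_ιOfLE _
  have : I.Additive := ⟨rfl⟩
  -- Reflection of finite generation enters here: a preimage under F of a finitely generated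
  -- projective module must again be finitely generated.
  have : G.EssSurj := ⟨fun Q => by
    let Q' : ProjMod S := ⟨Q.obj, Q.property.2⟩
    let i := (ObjectProperty.ι _).mapIso (F.objObjPreimageIso Q')
    let P := F.objPreimage Q'
    exact ⟨⟨P.obj, (hF P).mpr (UnitaryMod.isFGModule_of_iso i.symm Q.property.1), P.property⟩,
      ⟨ObjectProperty.isoMk _ i⟩⟩⟩
  exact ⟨G, { }, inferInstance⟩

theorem mainTheorem3 (R S : Type u) [NonUnitalRing R] [NonUnitalRing S]
    (hR : HasLocalUnits R) (hS : HasLocalUnits S) :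
    List.TFAE
      [AreMoritaEquivalent R S,
       ∃ F : ProjMod R ⥤ ProjMod S, F.IsEquivalence ∧ F.Additive ∧
         ∀ P : ProjMod R,
           IsFGModule R P.obj.carrier ↔ IsFGModule S (F.obj P).obj.carrier,
       ∃ F : FGProjMod R ⥤ FGProjMod S, F.IsEquivalence ∧ F.Additive] := by
  tfae_have 1 → 2 := fun ⟨E⟩ => exists_equivalence_ProjMod hR hS E
  tfae_have 2 → 3 := fun ⟨F, _, _, hF⟩ => exists_equivalence_FGProjMod F hF
  tfae_have 3 → 1 := fun ⟨F, _, _⟩ => areMoritaEquivalent_of_FGProjMod hR hS F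
  tfae_finish
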